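/- Fix a circle $\Omega$ (the absolute) of positive radius in the Euclidean plane. The h-plane is the set of points inside $\Omega$ (the Poincaré disk), and the h-lines are the intersections of the h-plane with the circles and lines perpendicular to $\Omega$. For distinct points $Q,A$ of the h-plane, the h-segment $[QA]_h$ is the arc with endpoints $Q$ and $A$ of the unique h-line through them (a circle arc or a Euclidean segment). For points $A,B\neq Q$ of the h-plane, the h-angle measure $\measuredangle_h AQB\in(-\pi,\pi]$ is the signed Euclidean angle measure $\measuredangle XQY$, where $[QX)$ and $[QY)$ are the half-lines tangent at $Q$ to $[QA]_h$ and $[QB]_h$ respectively. A triangle in the h-plane is an ordered triple of distinct points of the h-plane; it is nondegenerate if its vertices do not lie on one h-line. Theorem. Every nondegenerate triangle $ABC$ in the h-plane has positive defect, i.e. $$\pi-\bigl(|\measuredangle_h ABC|+|\measuredangle_h BCA|+|\measuredangle_h CAB|\bigr)>0 .$$ -/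

import Mathlib

open EuclideanGeometry

namespace PoincareDisk

section Arcs

variable {V P : Type*} [NormedAddCommGroup V] [InnerProductSpace ℝ V] [MetricSpace P]
  [NormedAddTorsor V P]

/-- The arc `ABC` of the circle `S`: the points `A`, `C`, and all points of `S` that lie with `B`
on the same side of the line `AC`. -/
def circleArc (S : Sphere P) (A B C : P) : Set P :=
  {D | D ∈ S ∧ (D = A ∨ D = C ∨ line[ℝ, A, C].SSameSide D B)}

/-- `IsTangentHalfLine γ A C X` : the set `γ` is an arc with (distinct) endpoints `A` and `C`, and
the half-line `[AX)` is tangent to `γ` at `A`.  An arc is a circle arc, or a segment, or a line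
without the points strictly between `A` and `C`. The affine subspace `S.orthRadius A` is the
tangent line to the circle `S` at its point `A`. -/
inductive IsTangentHalfLine : Set P → P → P → P → Prop
  | circle (S : Sphere P) (A B C X : P) (hA : A ∈ S) (hB : B ∈ S) (hC : C ∈ S)
      (hAB : A ≠ B) (hBC : B ≠ C) (hAC : A ≠ C)
      (hX : X ∈ S.orthRadius A) (hside : line[ℝ, A, C].SSameSide X B) :
      IsTangentHalfLine (circleArc S A B C) A C X
  | segment (A C X : P) (hAC : A ≠ C) (hAX : X ≠ A) (hX : SameRay ℝ (C -ᵥ A) (X -ᵥ A)) :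
      IsTangentHalfLine (affineSegment ℝ A C) A C X
  | exterior (A C X : P) (hAC : A ≠ C) (hX : Sbtw ℝ X A C) :
      IsTangentHalfLine {D | D ∈ line[ℝ, A, C] ∧ ¬ Sbtw ℝ A D C} A C X

/-- The h-plane with absolute `Ω`: the points inside the circle `Ω`. -/
def hPlane (Ω : Sphere P) : Set P := Metric.ball Ω.center Ω.radius

/-- `Γ` is a cline (a circle or a line) that is perpendicular to the circle `Ω`: the two meet at
some point `X`, and their tangent lines at `X` are perpendicular. -/
def IsPerpCline (Ω : Sphere P) (Γ : Set P) : Prop :=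
  (∃ S : Sphere P, 0 < S.radius ∧ Γ = (S : Set P) ∧
    ∃ X, X ∈ S ∧ X ∈ Ω ∧ (S.orthRadius X).direction ⟂ (Ω.orthRadius X).direction) ∨
  (∃ m : AffineSubspace ℝ P, Module.finrank ℝ m.direction = 1 ∧ Γ = (m : Set P) ∧
    ∃ X, X ∈ m ∧ X ∈ Ω ∧ m.direction ⟂ (Ω.orthRadius X).direction)

/-- The h-lines: intersections of the h-plane with clines perpendicular to the absolute. -/
def IsHLine (Ω : Sphere P) (l : Set P) : Prop :=
  ∃ Γ : Set P, IsPerpCline Ω Γ ∧ l = hPlane Ω ∩ Γ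

/-- The half-line `[QX)` is tangent at `Q` to the h-segment `[QA]_h`, which is the arc with
endpoints `Q` and `A` that is contained in an h-line. -/
def IsTangentToHSegment (Ω : Sphere P) (Q A X : P) : Prop :=
  ∃ γ l : Set P, IsHLine Ω l ∧ γ ⊆ l ∧ IsTangentHalfLine γ Q A X

/-- A triangle of the h-plane: an ordered triple of distinct points. -/
structure IsHTriangle (Ω : Sphere P) (A B C : P) : Prop where
  left_mem : A ∈ hPlane Ω
  mid_mem : B ∈ hPlane Ω
  right_mem : C ∈ hPlane Ω
  left_ne_mid : A ≠ B
  mid_ne_right : B ≠ C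
  right_ne_left : C ≠ A

/-- The triangle `ABC` of the h-plane is degenerate if its vertices lie on one h-line. -/
def IsHDegenerate (Ω : Sphere P) (A B C : P) : Prop :=
  ∃ l : Set P, IsHLine Ω l ∧ A ∈ l ∧ B ∈ l ∧ C ∈ l

end Arcs

section Angles

variable {V P : Type*} [NormedAddCommGroup V] [InnerProductSpace ℝ V] [MetricSpace P]
  [NormedAddTorsor V P] [Fact (Module.finrank ℝ V = 2)] [Module.Oriented ℝ V (Fin 2)]

/-- `θ` is the h-angle measure of the h-angle `AQB`: it is the Euclidean angle measure in
`(-π, π]` of `XQY`, where `[QX)` and `[QY)` are tangent at `Q` to `[QA]_h` and `[QB]_h`. -/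
def IsHAngleMeasure (Ω : Sphere P) (A Q B : P) (θ : ℝ) : Prop :=
  ∃ X Y : P, IsTangentToHSegment Ω Q A X ∧ IsTangentToHSegment Ω Q B Y ∧ θ = (∡ X Q Y).toReal

/-- The h-angle measure of `AQB`, the number `θ` with `IsHAngleMeasure Ω A Q B θ`. -/
noncomputable def hAngle (Ω : Sphere P) (A Q B : P) : ℝ :=
  Classical.epsilon (IsHAngleMeasure Ω A Q B)

/-- The defect of the triangle `ABC` of the h-plane. -/
noncomputable def hDefect (Ω : Sphere P) (A B C : P) : ℝ :=
  Real.pi - (|hAngle Ω A B C| + |hAngle Ω B C A| + |hAngle Ω C A B|)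

end Angles

end PoincareDisk

namespace PoincareDisk

open Real InnerProductGeometry

/-! The source of positivity is the second hyperbolic law of cosines, `cos γ + cos α cos β = sin α
sin β cosh c`. In a nondegenerate triangle the sines are positive and `cosh c > 1`, so `cos (π - γ)
< cos (α + β)`; two such inequalities force `α + β + γ < π`.

Take the centre of the absolute as origin. The vector `tangentVec r q a` is tangent at `q` to every
circle through `q` and `a` orthogonal to the absolute, and is polynomial in `q` and `a`. Inner
products of such vectors are polynomials in the squared distances and the quantities `r ^ 2 - ‖·‖ ^
2`. The Gram determinant at `a` is `(r ^ 2 - ‖a‖ ^ 2) ^ 2` times the symmetric `gramFactor`, which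
is positive because parallel tangents at a vertex would put all three vertices on one h-line. With
`cosh c = 1 + 2 r² ‖b - a‖² / ((r² - ‖a‖²) (r² - ‖b‖²))`, the identity
`inner_mul_add_inner_mul_inner_tangentVec` is the law of cosines cleared of denominators.

It remains to see that the half-lines in the definition of the h-angle exist and all point along
`tangentVec`. The delicate point is the sign: of the two arcs of an orthogonal circle between `Q`
and `A`, the one beyond the chord as seen from the centre contains the inverse of `Q`, so only the
other lies in the disk. -/

theorem add_add_lt_pi_of_cos {α β γ : ℝ} (hα₀ : 0 ≤ α) (hα : α ≤ π) (hβ₀ : 0 ≤ β) (hβ : β ≤ π)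
    (hγ₀ : 0 ≤ γ) (hγ : γ ≤ π) (h₁ : 0 < cos γ + cos α * cos β - sin α * sin β)
    (h₂ : 0 < cos α + cos β * cos γ - sin β * sin γ) : α + β + γ < π := by
  -- The hypothesis says `cos (π - z) < cos (x + y)`. The second alternative arises when `x + y`
  -- exceeds `π` and is reflected to `2 * π - (x + y)`; holding for both pairs, it would give `2 * π
  -- < 2 * β`.
  have key : ∀ {x y z : ℝ}, 0 ≤ x → x ≤ π → 0 ≤ y → y ≤ π → 0 ≤ z → z ≤ π →
      0 < cos z + cos x * cos y - sin x * sin y → x + y + z < π ∨ π < x + y - z := by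
    intro x y z hx₀ hx hy₀ hy hz₀ hz h
    have h' : cos (π - z) < cos (x + y) := by
      rw [cos_pi_sub, cos_add]; linarith
    rcases le_total (x + y) π with hxy | hxy
    · left
      by_contra! hc
      have := cos_le_cos_of_nonneg_of_le_pi (x := π - z) (y := x + y) (by linarith) hxy
        (by linarith)
      linarith
    · right
      by_contra! hc
      have := cos_le_cos_of_nonneg_of_le_pi (x := π - z) (y := 2 * π - (x + y)) (by linarith)
        (by linarith) (by linarith)
      rw [cos_two_pi_sub] at this
      linarith
  rcases key hα₀ hα hβ₀ hβ hγ₀ hγ h₁ with h | h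
  · exact h
  rcases key hβ₀ hβ hγ₀ hγ hα₀ hα h₂ with h' | h'
  · linarith
  · linarith

/-! ### The law of cosines in polynomial form -/

section Norm

variable {V : Type*} [NormedAddCommGroup V] {r : ℝ} {a b : V}

theorem sq_sub_sq_pos (ha : ‖a‖ < r) : 0 < r ^ 2 - ‖a‖ ^ 2 := by
  have := norm_nonneg a
  nlinarith

theorem norm_sub_sq_pos (hab : a ≠ b) : 0 < ‖b - a‖ ^ 2 :=
  pow_pos (norm_pos_iff.2 (sub_ne_zero.2 hab.symm)) 2

/-- The part of the Gram determinant of the directions `tangentVec r a b` and `tangentVec r a c`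
that is symmetric in `a`, `b`, `c`. -/
noncomputable def gramFactor (r : ℝ) (a b c : V) : ℝ :=
  ‖b - a‖ ^ 2 * ‖c - a‖ ^ 2 * (r ^ 2 - ‖b‖ ^ 2) * (r ^ 2 - ‖c‖ ^ 2) +
    r ^ 2 * ‖b - a‖ ^ 2 * ‖c - a‖ ^ 2 * ‖c - b‖ ^ 2 -
    ((r ^ 2 - ‖b‖ ^ 2) * ‖c - a‖ ^ 2 + (r ^ 2 - ‖c‖ ^ 2) * ‖b - a‖ ^ 2 -
      (r ^ 2 - ‖a‖ ^ 2) * ‖c - b‖ ^ 2) ^ 2 / 4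

theorem gramFactor_rotate (r : ℝ) (a b c : V) : gramFactor r b c a = gramFactor r a b c := by
  simp only [gramFactor, norm_sub_rev a b, norm_sub_rev a c]
  ring

end Norm

section TangentVector

variable {V : Type*} [NormedAddCommGroup V] [InnerProductSpace ℝ V]

/-- The direction in which the h-segment from `q` to `a` leaves `q`, where the absolute is the
circle of radius `r` about the origin. -/
noncomputable def tangentVec (r : ℝ) (q a : V) : V :=
  (r ^ 2 - ‖q‖ ^ 2) • (a - q) - ‖a - q‖ ^ 2 • q

/-- Polarization removes every inner product of points, so the later identities are settled by
`ring` in squared distances and powers of points. -/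
theorem two_mul_inner_tangentVec_tangentVec (r : ℝ) (a b c : V) :
    2 * inner ℝ (tangentVec r a b) (tangentVec r a c) =
      2 * r ^ 2 * ‖b - a‖ ^ 2 * ‖c - a‖ ^ 2 + (r ^ 2 - ‖a‖ ^ 2) *
        ((r ^ 2 - ‖b‖ ^ 2) * ‖c - a‖ ^ 2 + (r ^ 2 - ‖c‖ ^ 2) * ‖b - a‖ ^ 2 -
          (r ^ 2 - ‖a‖ ^ 2) * ‖c - b‖ ^ 2) := by
  simp only [tangentVec, ← real_inner_self_eq_norm_sq, inner_sub_left, inner_sub_right,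
    real_inner_smul_left, real_inner_smul_right, real_inner_comm a b, real_inner_comm a c,
    real_inner_comm b c]
  ring

theorem inner_tangentVec_self (r : ℝ) (a b : V) :
    inner ℝ (tangentVec r a b) (tangentVec r a b) =
      ‖b - a‖ ^ 2 * ((r ^ 2 - ‖a‖ ^ 2) * (r ^ 2 - ‖b‖ ^ 2) + r ^ 2 * ‖b - a‖ ^ 2) := by
  have := two_mul_inner_tangentVec_tangentVec r a b b
  rw [sub_self, norm_zero] at this
  linear_combination this / 2

theorem gram_tangentVec (r : ℝ) (a b c : V) :
    inner ℝ (tangentVec r a b) (tangentVec r a b) * inner ℝ (tangentVec r a c) (tangentVec r a c) -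
      inner ℝ (tangentVec r a b) (tangentVec r a c) * inner ℝ (tangentVec r a b) (tangentVec r a c)
      = (r ^ 2 - ‖a‖ ^ 2) ^ 2 * gramFactor r a b c := by
  have h : inner ℝ (tangentVec r a b) (tangentVec r a c) = _ :=
    (eq_div_iff two_ne_zero).2 ((mul_comm _ _).trans (two_mul_inner_tangentVec_tangentVec r a b c))
  rw [inner_tangentVec_self, inner_tangentVec_self, h, gramFactor]
  ring

theorem inner_mul_add_inner_mul_inner_tangentVec (r : ℝ) (a b c : V) :
    inner ℝ (tangentVec r c a) (tangentVec r c b) *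
        inner ℝ (tangentVec r a b) (tangentVec r a b) +
      inner ℝ (tangentVec r a b) (tangentVec r a c) *
        inner ℝ (tangentVec r b c) (tangentVec r b a) =
      gramFactor r a b c *
        ((r ^ 2 - ‖a‖ ^ 2) * (r ^ 2 - ‖b‖ ^ 2) + 2 * r ^ 2 * ‖b - a‖ ^ 2) := by
  have h (a b c : V) : inner ℝ (tangentVec r a b) (tangentVec r a c) = _ :=
    (eq_div_iff two_ne_zero).2 ((mul_comm _ _).trans (two_mul_inner_tangentVec_tangentVec r a b c))
  rw [inner_tangentVec_self, h, h, h, gramFactor, norm_sub_rev a b, norm_sub_rev a c,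
    norm_sub_rev b c]
  ring

variable {r : ℝ} {a b c : V}

theorem norm_tangentVec_comm (r : ℝ) (a b : V) : ‖tangentVec r b a‖ = ‖tangentVec r a b‖ := by
  refine (sq_eq_sq₀ (norm_nonneg _) (norm_nonneg _)).1 ?_
  rw [← real_inner_self_eq_norm_sq, ← real_inner_self_eq_norm_sq, inner_tangentVec_self,
    inner_tangentVec_self, norm_sub_rev a b]
  ring

theorem tangentVec_ne_zero (ha : ‖a‖ < r) (hb : ‖b‖ < r) (hab : a ≠ b) : tangentVec r a b ≠ 0 := by
  rw [← norm_pos_iff]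
  refine lt_of_le_of_ne (norm_nonneg _) fun h ↦ ?_
  have h' := inner_tangentVec_self r a b
  rw [real_inner_self_eq_norm_sq, ← h] at h'
  have := sq_sub_sq_pos ha
  have := sq_sub_sq_pos hb
  have := norm_sub_sq_pos hab
  have : 0 < ‖b - a‖ ^ 2 *
      ((r ^ 2 - ‖a‖ ^ 2) * (r ^ 2 - ‖b‖ ^ 2) + r ^ 2 * ‖b - a‖ ^ 2) := by positivity
  linarith

theorem cos_add_cos_mul_cos_sub_sin_mul_sin_pos (ha : ‖a‖ < r) (hb : ‖b‖ < r) (hc : ‖c‖ < r)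
    (hab : a ≠ b) (hbc : b ≠ c) (hca : c ≠ a) (hE : 0 < gramFactor r a b c) :
    0 < cos (InnerProductGeometry.angle (tangentVec r c a) (tangentVec r c b)) +
      cos (InnerProductGeometry.angle (tangentVec r a b) (tangentVec r a c)) *
        cos (InnerProductGeometry.angle (tangentVec r b c) (tangentVec r b a)) -
      sin (InnerProductGeometry.angle (tangentVec r a b) (tangentVec r a c)) *
        sin (InnerProductGeometry.angle (tangentVec r b c) (tangentVec r b a)) := by
  have hA := sq_sub_sq_pos ha
  have hB := sq_sub_sq_pos hb
  have hr : 0 < r := (norm_nonneg a).trans_lt ha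
  have hD := norm_sub_sq_pos hab
  have hn₁ := norm_pos_iff.2 (tangentVec_ne_zero ha hb hab)
  have hn₂ := norm_pos_iff.2 (tangentVec_ne_zero hb hc hbc)
  have hn₃ := norm_pos_iff.2 (tangentVec_ne_zero hc ha hca)
  have c₁ := cos_angle_mul_norm_mul_norm (tangentVec r c a) (tangentVec r c b)
  have c₂ := cos_angle_mul_norm_mul_norm (tangentVec r a b) (tangentVec r a c)
  have c₃ := cos_angle_mul_norm_mul_norm (tangentVec r b c) (tangentVec r b a)
  have s₂ := sin_angle_mul_norm_mul_norm (tangentVec r a b) (tangentVec r a c)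
  have s₃ := sin_angle_mul_norm_mul_norm (tangentVec r b c) (tangentVec r b a)
  rw [gram_tangentVec, sqrt_mul (sq_nonneg _), sqrt_sq hA.le] at s₂
  rw [gram_tangentVec, sqrt_mul (sq_nonneg _), sqrt_sq hB.le, gramFactor_rotate] at s₃
  have key := inner_mul_add_inner_mul_inner_tangentVec r a b c
  rw [← c₁, ← c₂, ← c₃, real_inner_self_eq_norm_sq] at key
  rw [norm_tangentVec_comm r b c] at c₁ key
  rw [norm_tangentVec_comm r c a] at c₂ s₂ key
  rw [norm_tangentVec_comm r a b] at c₃ s₃ key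
  have hS := Real.mul_self_sqrt hE.le
  set N₁ := ‖tangentVec r a b‖
  set N₂ := ‖tangentVec r b c‖
  set N₃ := ‖tangentVec r c a‖
  have hN : 0 < N₁ ^ 2 * N₂ * N₃ := by positivity
  refine pos_of_mul_pos_left (b := N₁ ^ 2 * N₂ * N₃) ?_ hN.le
  -- This is the term `sin α sin β (cosh c - 1)` after multiplication by `N₁ ^ 2 * N₂ * N₃`.
  have hpos : 0 < gramFactor r a b c * (2 * r ^ 2 * ‖b - a‖ ^ 2) := by positivity
  refine hpos.trans_eq ?_
  set T := √(gramFactor r a b c)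
  set sα := sin (InnerProductGeometry.angle (tangentVec r a b) (tangentVec r a c))
  set sβ := sin (InnerProductGeometry.angle (tangentVec r b c) (tangentVec r b a))
  have hs : sα * sβ * (N₁ ^ 2 * N₂ * N₃) =
      (r ^ 2 - ‖a‖ ^ 2) * (r ^ 2 - ‖b‖ ^ 2) * gramFactor r a b c := by
    rw [← hS]
    linear_combination (sβ * (N₂ * N₁)) * s₂ + ((r ^ 2 - ‖a‖ ^ 2) * T) * s₃
  linear_combination hs - key

theorem angle_add_angle_add_angle_lt_pi (ha : ‖a‖ < r) (hb : ‖b‖ < r) (hc : ‖c‖ < r)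
    (hab : a ≠ b) (hbc : b ≠ c) (hca : c ≠ a) (hE : 0 < gramFactor r a b c) :
    InnerProductGeometry.angle (tangentVec r a b) (tangentVec r a c) +
      InnerProductGeometry.angle (tangentVec r b c) (tangentVec r b a) +
      InnerProductGeometry.angle (tangentVec r c a) (tangentVec r c b) < π :=
  add_add_lt_pi_of_cos (angle_nonneg _ _) (angle_le_pi _ _) (angle_nonneg _ _) (angle_le_pi _ _)
    (angle_nonneg _ _) (angle_le_pi _ _)
    (cos_add_cos_mul_cos_sub_sin_mul_sin_pos ha hb hc hab hbc hca hE)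
    (cos_add_cos_mul_cos_sub_sin_mul_sin_pos hb hc ha hbc hca hab (by rwa [gramFactor_rotate]))

end TangentVector

end PoincareDisk

namespace PoincareDisk

/-! ### Circles orthogonal to the absolute -/

section Orthogonal

variable {V : Type*} [NormedAddCommGroup V] [InnerProductSpace ℝ V]

theorem inner_tangentVec_sub_center {r : ℝ} {q a m : V} (hq : ‖q‖ ^ 2 + r ^ 2 = 2 * inner ℝ q m)
    (ha : ‖a‖ ^ 2 + r ^ 2 = 2 * inner ℝ a m) : inner ℝ (tangentVec r q a) (q - m) = 0 := by
  simp only [tangentVec, ← real_inner_self_eq_norm_sq, inner_sub_left, inner_sub_right,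
    real_inner_smul_left, real_inner_comm q a] at *
  linear_combination
    -(r ^ 2 + inner ℝ a a - 2 * inner ℝ q a) / 2 * hq + (r ^ 2 - inner ℝ q q) / 2 * ha

theorem sub_center_ne_zero {r : ℝ} {q m : V} (hqr : ‖q‖ < r)
    (hq : ‖q‖ ^ 2 + r ^ 2 = 2 * inner ℝ q m) : q - m ≠ 0 := by
  intro h
  rw [← sub_eq_zero.1 h, real_inner_self_eq_norm_sq] at hq
  linarith [sq_sub_sq_pos hqr]

/-- The h-line through `q` with normal `n`, if it is not a diameter, is part of a circle with
centre `m` and radius `ρ`. -/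
theorem exists_center_radius {r : ℝ} {q n : V} (hqr : ‖q‖ < r) (hn : inner ℝ q n ≠ 0) :
    ∃ (m : V) (ρ : ℝ), 0 < ρ ∧ ‖m‖ ^ 2 = r ^ 2 + ρ ^ 2 ∧
      ∀ p : V, inner ℝ (tangentVec r q p) n = 0 → ‖p‖ ^ 2 + r ^ 2 = 2 * inner ℝ p m := by
  have hA := sq_sub_sq_pos hqr
  have hn0 : n ≠ 0 := by rintro rfl; simp at hn
  -- The centre lies on the normal at `q`, and `s` solves `‖q‖ ^ 2 + r ^ 2 = 2 * inner ℝ q (q + s •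
  -- n)`.
  obtain ⟨s, hs⟩ : ∃ s : ℝ, 2 * s * inner ℝ q n = r ^ 2 - ‖q‖ ^ 2 :=
    ⟨(r ^ 2 - ‖q‖ ^ 2) / (2 * inner ℝ q n), by field_simp⟩
  have hs0 : s ≠ 0 := by rintro rfl; simp at hs; linarith
  refine ⟨q + s • n, |s| * ‖n‖, mul_pos (abs_pos.2 hs0) (norm_pos_iff.2 hn0), ?_, fun p hp ↦ ?_⟩
  · rw [norm_add_sq_real, real_inner_smul_right, norm_smul, Real.norm_eq_abs]
    linear_combination hs
  · refine mul_left_cancel₀ hn ?_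
    simp only [tangentVec, ← real_inner_self_eq_norm_sq, inner_sub_left, inner_sub_right,
      inner_add_right, real_inner_smul_left, real_inner_smul_right, real_inner_comm q p] at *
    linear_combination (-inner ℝ p n) * hs - hp

end Orthogonal

section TwoDim

variable {V : Type*} [NormedAddCommGroup V] [InnerProductSpace ℝ V]
  [Fact (Module.finrank ℝ V = 2)] (o : Orientation ℝ V (Fin 2))

theorem exists_eq_smul_of_areaForm_eq_zero {x y : V} (hx : x ≠ 0) (h : o.areaForm x y = 0) :
    ∃ k : ℝ, y = k • x := by
  rw [← o.inner_rightAngleRotation_left,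
    o.inner_eq_zero_iff_eq_zero_or_eq_smul_rotation_pi_div_two] at h
  rcases h with h | ⟨k, rfl⟩
  · simp_all
  · exact ⟨-k, by simp [o.rotation_pi_div_two]⟩

theorem areaForm_eq_zero_of_inner_eq_zero {x y z : V} (hz : z ≠ 0) (hx : inner ℝ x z = 0)
    (hy : inner ℝ y z = 0) : o.areaForm x y = 0 := by
  have h := o.inner_mul_areaForm_sub z x y
  rw [real_inner_comm, hx, real_inner_comm, hy] at h
  have : ‖z‖ ^ 2 ≠ 0 := pow_ne_zero 2 (norm_ne_zero_iff.2 hz)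
  simpa [this] using h.symm

theorem inner_eq_zero_of_isOrtho_orthogonal {x y : V}
    (h : (ℝ ∙ x)ᗮ ⟂ (ℝ ∙ y)ᗮ) : inner ℝ x y = 0 := by
  have : FiniteDimensional ℝ V := .of_fact_finrank_eq_two
  let o : Orientation ℝ V (Fin 2) :=
    ((stdOrthonormalBasis ℝ V).toBasis.reindex (finCongr Fact.out)).orientation
  rw [Submodule.isOrtho_iff_inner_eq] at h
  have := h (o.rightAngleRotation x)
    (Submodule.mem_orthogonal_singleton_iff_inner_right.2 (by simp)) (o.rightAngleRotation y)
    (Submodule.mem_orthogonal_singleton_iff_inner_right.2 (by simp))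
  simpa using this

theorem isOrtho_orthogonal_of_inner_eq_zero {x y : V} (hx : x ≠ 0) (hy : y ≠ 0)
    (h : inner ℝ x y = 0) : (ℝ ∙ x)ᗮ ⟂ (ℝ ∙ y)ᗮ := by
  have : FiniteDimensional ℝ V := .of_fact_finrank_eq_two
  let o : Orientation ℝ V (Fin 2) :=
    ((stdOrthonormalBasis ℝ V).toBasis.reindex (finCongr Fact.out)).orientation
  rw [Submodule.isOrtho_iff_inner_eq]
  intro u hu v hv
  rw [Submodule.mem_orthogonal_singleton_iff_inner_left] at hu hv
  obtain ⟨k, rfl⟩ := exists_eq_smul_of_areaForm_eq_zero o hy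
    (areaForm_eq_zero_of_inner_eq_zero o hx (by rwa [real_inner_comm]) hu)
  rw [real_inner_smul_left, real_inner_comm, hv, mul_zero]

theorem gramFactor_pos {r : ℝ} {a b c : V}
    (h : o.areaForm (tangentVec r a b) (tangentVec r a c) ≠ 0) : 0 < gramFactor r a b c := by
  have h₁ := gram_tangentVec r a b c
  have h₂ := o.inner_sq_add_areaForm_sq (tangentVec r a b) (tangentVec r a c)
  rw [real_inner_self_eq_norm_sq, real_inner_self_eq_norm_sq] at h₁
  have h₃ : 0 < (r ^ 2 - ‖a‖ ^ 2) ^ 2 * gramFactor r a b c := by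
    rw [← h₁, ← h₂]
    have : 0 < o.areaForm (tangentVec r a b) (tangentVec r a c) ^ 2 := by positivity
    linarith
  exact pos_of_mul_pos_right h₃ (sq_nonneg _)

/-- Since `-q` points from `q` to the origin, the sign shows that the tangent vector points to the
origin's side of the chord. -/
theorem areaForm_sub_tangentVec (r : ℝ) (q a : V) :
    o.areaForm (a - q) (tangentVec r q a) = -(‖a - q‖ ^ 2 * o.areaForm (a - q) q) := by
  rw [tangentVec, map_sub, map_smul, map_smul, o.areaForm_apply_self]
  simp

/-- If the arc from `q` to `a` on the side of `b` of a circle with centre `m` orthogonal to the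
absolute stays in the disk, then its tangent half-line at `q` has the direction
`tangentVec r q a`. -/
theorem exists_pos_eq_smul_tangentVec {r : ℝ} {q a m b x : V} (hqr : ‖q‖ < r) (har : ‖a‖ < r)
    (hqa : q ≠ a) (hq : ‖q‖ ^ 2 + r ^ 2 = 2 * inner ℝ q m)
    (ha : ‖a‖ ^ 2 + r ^ 2 = 2 * inner ℝ a m) (hx : inner ℝ x (q - m) = 0)
    (hxb : 0 < o.areaForm (a - q) x * o.areaForm (a - q) (b - q))
    (harc : ∀ d : V, ‖d‖ ^ 2 + r ^ 2 = 2 * inner ℝ d m →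
      0 < o.areaForm (a - q) (d - q) * o.areaForm (a - q) (b - q) → ‖d‖ < r) :
    ∃ k : ℝ, 0 < k ∧ x = k • tangentVec r q a := by
  obtain ⟨k, rfl⟩ := exists_eq_smul_of_areaForm_eq_zero o (tangentVec_ne_zero hqr har hqa)
    (areaForm_eq_zero_of_inner_eq_zero o (sub_center_ne_zero hqr hq)
      (inner_tangentVec_sub_center hq ha) hx)
  refine ⟨k, ?_, rfl⟩
  rw [map_smul, areaForm_sub_tangentVec, smul_eq_mul] at hxb
  have hD := norm_sub_sq_pos hqa
  by_contra! hk
  have hside : 0 < o.areaForm (a - q) q * o.areaForm (a - q) (b - q) := by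
    have hne : o.areaForm (a - q) q * o.areaForm (a - q) (b - q) ≠ 0 := by
      rintro h
      have : k * -(‖a - q‖ ^ 2 * o.areaForm (a - q) q) * o.areaForm (a - q) (b - q) = 0 := by
        linear_combination -k * ‖a - q‖ ^ 2 * h
      linarith
    refine lt_of_le_of_ne ?_ hne.symm
    by_contra! hneg
    nlinarith [mul_nonneg_of_nonpos_of_nonpos hk
      (mul_nonpos_of_nonneg_of_nonpos hD.le hneg.le)]
  have hq0 : q ≠ 0 := by
    rintro rfl
    simp at hside
  have hn : 0 < ‖q‖ := norm_pos_iff.2 hq0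
  have hr : 0 < r := hn.trans hqr
  have hlt : 1 < r ^ 2 / ‖q‖ ^ 2 := by
    rw [one_lt_div (by positivity)]
    linarith [sq_sub_sq_pos hqr]
  -- If `k ≤ 0`, then `b` and the origin are on opposite sides of the chord. The inverse of `q` in
  -- the absolute lies on the orthogonal circle and on the side of `b`, yet outside the disk.
  have := harc ((r ^ 2 / ‖q‖ ^ 2) • q) ?_ ?_
  · rw [norm_smul, Real.norm_of_nonneg (by positivity)] at this
    have h : r ^ 2 / ‖q‖ ^ 2 * ‖q‖ = r * (r / ‖q‖) := by field_simp
    rw [h] at this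
    have : 1 < r / ‖q‖ := (one_lt_div hn).2 hqr
    nlinarith
  · rw [norm_smul, Real.norm_of_nonneg (by positivity), real_inner_smul_left]
    have h : r ^ 2 / ‖q‖ ^ 2 * ‖q‖ ^ 2 = r ^ 2 := by field_simp
    linear_combination (r ^ 2 / ‖q‖ ^ 2) * hq + (r ^ 2 / ‖q‖ ^ 2 - 1) * h
  · have h : (r ^ 2 / ‖q‖ ^ 2) • q - q = (r ^ 2 / ‖q‖ ^ 2 - 1) • q := by module
    rw [h, map_smul, smul_eq_mul, mul_assoc]
    exact mul_pos (by linarith) hside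

/-- The points of a circle with centre `m` orthogonal to the absolute that lie with the origin on
the same side of the chord `qa` are in the disk if `q` and `a` are. -/
theorem norm_lt_of_areaForm_mul_areaForm_neg {r : ℝ} {q a m d : V} (hqr : ‖q‖ < r) (har : ‖a‖ < r)
    (hqa : q ≠ a) (hq : ‖q‖ ^ 2 + r ^ 2 = 2 * inner ℝ q m)
    (ha : ‖a‖ ^ 2 + r ^ 2 = 2 * inner ℝ a m) (hd : ‖d‖ ^ 2 + r ^ 2 = 2 * inner ℝ d m)
    (hside : o.areaForm (a - q) (d - q) * o.areaForm (a - q) q < 0) : ‖d‖ < r := by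
  have hW : o.areaForm q a ≠ 0 := by
    intro h
    simp [o.areaForm_swap a q, h] at hside
  have hq0 : q ≠ 0 := by rintro rfl; simp at hW
  obtain ⟨k, hk⟩ := exists_eq_smul_of_areaForm_eq_zero o
    (y := o.areaForm q a • d - o.areaForm q d • a) hq0 (by simp; ring)
  obtain ⟨α, β, rfl⟩ : ∃ α β : ℝ, d = α • q + β • a := by
    refine ⟨k / o.areaForm q a, o.areaForm q d / o.areaForm q a, ?_⟩
    rw [div_eq_inv_mul, mul_smul, ← hk, div_eq_inv_mul, mul_smul, ← smul_add,
      sub_add_cancel, inv_smul_smul₀ hW]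
  have hγ : α + β < 1 := by
    by_contra! h
    simp only [map_sub, map_add, map_smul, LinearMap.sub_apply, o.areaForm_apply_self,
      o.areaForm_swap a q, smul_eq_mul] at hside
    nlinarith [mul_nonneg (sub_nonneg.2 h) (sq_nonneg (o.areaForm q a))]
  have hA := sq_sub_sq_pos hqr
  have hB := sq_sub_sq_pos har
  have hD := norm_sub_sq_pos hqa
  -- As squares are nonnegative and `α + β < 1`, these two formulas force `α, β ≥ 0`; so `d` lies in
  -- the triangle with vertices `0`, `q`, `a`.
  have h₁ : ‖α • q + β • a - a‖ ^ 2 = α * ‖a - q‖ ^ 2 - (1 - α - β) * (r ^ 2 - ‖a‖ ^ 2) := by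
    simp only [← real_inner_self_eq_norm_sq, inner_sub_left, inner_sub_right, inner_add_left,
      inner_add_right, real_inner_smul_left, real_inner_smul_right, real_inner_comm q a] at *
    linear_combination hd - α * hq - β * ha
  have h₂ : ‖α • q + β • a - q‖ ^ 2 = β * ‖a - q‖ ^ 2 - (1 - α - β) * (r ^ 2 - ‖q‖ ^ 2) := by
    simp only [← real_inner_self_eq_norm_sq, inner_sub_left, inner_sub_right, inner_add_left,
      inner_add_right, real_inner_smul_left, real_inner_smul_right, real_inner_comm q a] at *
    linear_combination hd - α * hq - β * ha
  have hα : 0 ≤ α := by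
    by_contra! h
    nlinarith [sq_nonneg ‖α • q + β • a - a‖, mul_pos (sub_pos.2 hγ) hB]
  have hβ : 0 ≤ β := by
    by_contra! h
    nlinarith [sq_nonneg ‖α • q + β • a - q‖, mul_pos (sub_pos.2 hγ) hA]
  have hr : 0 < r := (norm_nonneg q).trans_lt hqr
  calc ‖α • q + β • a‖ ≤ α * ‖q‖ + β * ‖a‖ := by
        refine (norm_add_le _ _).trans_eq ?_
        rw [norm_smul, norm_smul, Real.norm_of_nonneg hα, Real.norm_of_nonneg hβ]
    _ ≤ α * r + β * r := by gcongr
    _ < r := by nlinarith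

end TwoDim

end PoincareDisk

namespace PoincareDisk

theorem mem_hPlane_iff {V P : Type*} [NormedAddCommGroup V] [MetricSpace P] [NormedAddTorsor V P]
    {Ω : Sphere P} {A : P} : A ∈ hPlane Ω ↔ ‖A -ᵥ Ω.center‖ < Ω.radius := by
  rw [hPlane, Metric.mem_ball, dist_eq_norm_vsub V]

/-! ### Perpendicular clines and sides of a line -/

section Lines

variable {V P : Type*} [NormedAddCommGroup V] [InnerProductSpace ℝ V] [MetricSpace P]
  [NormedAddTorsor V P]

/-- Orthogonality cancels the constant terms when `‖D - m‖ ^ 2 = ρ ^ 2` is expanded. -/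
theorem mem_sphere_iff_of_norm_sq_eq {Ω S : Sphere P} (hS : 0 < S.radius)
    (h : ‖S.center -ᵥ Ω.center‖ ^ 2 = Ω.radius ^ 2 + S.radius ^ 2) {D : P} :
    D ∈ S ↔ ‖D -ᵥ Ω.center‖ ^ 2 + Ω.radius ^ 2 =
      2 * inner ℝ (D -ᵥ Ω.center) (S.center -ᵥ Ω.center) := by
  rw [mem_sphere, dist_eq_norm_vsub V, ← sq_eq_sq₀ (norm_nonneg _) hS.le,
    ← vsub_sub_vsub_cancel_right D S.center Ω.center, norm_sub_sq_real, h]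
  constructor <;> intro h <;> linarith

theorem isPerpCline_mk' {Ω : Sphere P} (hΩ : 0 < Ω.radius) {v : V} (hv : v ≠ 0) :
    IsPerpCline Ω (AffineSubspace.mk' Ω.center (ℝ ∙ v) : Set P) := by
  have hv' := norm_pos_iff.2 hv
  refine .inr ⟨_, ?_, rfl, (Ω.radius / ‖v‖) • v +ᵥ Ω.center, ?_, ?_, ?_⟩
  · rw [AffineSubspace.direction_mk', finrank_span_singleton hv]
  · rw [AffineSubspace.mem_mk', vadd_vsub]
    exact Submodule.smul_mem _ _ (Submodule.mem_span_singleton_self v)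
  · rw [mem_sphere, dist_eq_norm_vsub V, vadd_vsub, norm_smul, norm_div, norm_norm,
      Real.norm_of_nonneg hΩ.le, div_mul_cancel₀ _ hv'.ne']
  · rw [AffineSubspace.direction_mk', Sphere.direction_orthRadius, vadd_vsub,
      Submodule.span_singleton_smul_eq (IsUnit.mk0 _ (div_pos hΩ hv').ne')]
    exact Submodule.isOrtho_orthogonal_right _

theorem mem_line_iff {Q A X : P} : X ∈ line[ℝ, Q, A] ↔ ∃ k : ℝ, k • (A -ᵥ Q) = X -ᵥ Q := by
  rw [← AffineSubspace.vsub_right_mem_direction_iff_mem (left_mem_affineSpan_pair ℝ Q A),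
    direction_affineSpan, mem_vectorSpan_pair_rev]

theorem midpoint_notMem_sphere {S : Sphere P} {Q A : P} (hQA : Q ≠ A) (hQ : Q ∈ S) (hA : A ∈ S) :
    midpoint ℝ Q A ∉ S := by
  intro h
  have hi := Cospherical.affineIndependent_of_mem_of_ne S.cospherical hQ h hA
    (by simpa using hQA) hQA (by simpa using hQA)
  rw [affineIndependent_iff_not_collinear_set] at hi
  exact hi (wbtw_midpoint ℝ Q A).collinear

theorem tangentVec_smul_sub {r k : ℝ} {q a : V} (h : q = k • (a - q)) :
    tangentVec r q a = (r ^ 2 - inner ℝ q a) • (a - q) := by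
  have ha : inner ℝ q a = (k ^ 2 + k) * ‖a - q‖ ^ 2 := by
    have : a = (k + 1) • (a - q) := by rw [add_smul, ← h]; module
    nth_rw 1 [this, h]
    rw [real_inner_smul_left, real_inner_smul_right, real_inner_self_eq_norm_sq]
    ring
  have hq : ‖q‖ ^ 2 = k ^ 2 * ‖a - q‖ ^ 2 := by
    nth_rw 1 [h]
    rw [norm_smul, mul_pow, Real.norm_eq_abs, sq_abs]
  have e : tangentVec r q a = (r ^ 2 - ‖q‖ ^ 2) • (a - q) - (‖a - q‖ ^ 2 * k) • (a - q) := by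
    rw [tangentVec, mul_smul, ← h]
  rw [e, hq, ha]
  module

theorem exists_pos_eq_smul_of_affineSegment {Ω : Sphere P} {Q A X : P} (hQ : Q ∈ hPlane Ω)
    (hA : A ∈ hPlane Ω) (hQA : Q ≠ A) (hXQ : X ≠ Q) (hX : SameRay ℝ (A -ᵥ Q) (X -ᵥ Q))
    {k : ℝ} (h : Q -ᵥ Ω.center = k • (A -ᵥ Q)) :
    ∃ k : ℝ, 0 < k ∧
      X -ᵥ Q = k • tangentVec Ω.radius (Q -ᵥ Ω.center) (A -ᵥ Ω.center) := by
  rw [mem_hPlane_iff] at hQ hA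
  rw [← vsub_sub_vsub_cancel_right A Q Ω.center] at h
  obtain ⟨c, hc, hcX⟩ := hX.exists_pos_left (vsub_ne_zero.2 hQA.symm) (vsub_ne_zero.2 hXQ)
  have hpos : 0 < Ω.radius ^ 2 - inner ℝ (Q -ᵥ Ω.center) (A -ᵥ Ω.center) := by
    have := real_inner_le_norm (Q -ᵥ Ω.center) (A -ᵥ Ω.center)
    nlinarith [norm_nonneg (Q -ᵥ Ω.center), norm_nonneg (A -ᵥ Ω.center)]
  refine ⟨c / (Ω.radius ^ 2 - inner ℝ (Q -ᵥ Ω.center) (A -ᵥ Ω.center)), div_pos hc hpos, ?_⟩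
  rw [tangentVec_smul_sub h, smul_smul, div_mul_cancel₀ _ hpos.ne', vsub_sub_vsub_cancel_right,
    hcX]

theorem not_subset_hPlane_of_exterior (Ω : Sphere P) {Q A : P} (hQA : Q ≠ A) :
    ¬ {D | D ∈ line[ℝ, Q, A] ∧ ¬ Sbtw ℝ Q D A} ⊆ hPlane Ω := by
  intro h
  have hd : 0 < ‖A -ᵥ Q‖ := norm_pos_iff.2 (vsub_ne_zero.2 hQA.symm)
  -- Far enough along the line beyond `A` to leave the disk, by the triangle inequality.
  set s : ℝ := 1 + (|Ω.radius| + ‖Q -ᵥ Ω.center‖) / ‖A -ᵥ Q‖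
  have hs : 1 ≤ s := le_add_of_nonneg_right (by positivity)
  have hmem := h (a := AffineMap.lineMap Q A s) ⟨AffineMap.lineMap_mem_affineSpan_pair _ _ _, ?_⟩
  · rw [mem_hPlane_iff, AffineMap.lineMap_apply, vadd_vsub_assoc] at hmem
    have h₁ := norm_sub_le (s • (A -ᵥ Q) + (Q -ᵥ Ω.center)) (Q -ᵥ Ω.center)
    rw [add_sub_cancel_right, norm_smul, Real.norm_of_nonneg (by linarith)] at h₁
    have h₂ : s * ‖A -ᵥ Q‖ = ‖A -ᵥ Q‖ + (|Ω.radius| + ‖Q -ᵥ Ω.center‖) := by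
      simp only [s]; field_simp
    linarith [le_abs_self Ω.radius]
  · rw [sbtw_lineMap_iff]
    exact fun h ↦ h.2.2.not_ge hs

theorem affineSegment_subset_hPlane {Ω : Sphere P} {Q A : P} (hQ : Q ∈ hPlane Ω)
    (hA : A ∈ hPlane Ω) : affineSegment ℝ Q A ⊆ hPlane Ω := by
  rintro _ ⟨t, ht, rfl⟩
  rw [mem_hPlane_iff] at *
  have : (AffineMap.lineMap Q A t : P) -ᵥ Ω.center =
      AffineMap.lineMap (Q -ᵥ Ω.center) (A -ᵥ Ω.center) t := by
    rw [AffineMap.lineMap_apply, AffineMap.lineMap_apply, vadd_vsub_assoc, vsub_eq_sub,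
      vsub_sub_vsub_cancel_right, vadd_eq_add]
  rw [this, ← mem_ball_zero_iff]
  exact (convex_ball (0 : V) Ω.radius).segment_subset (mem_ball_zero_iff.2 hQ)
    (mem_ball_zero_iff.2 hA) (by rw [← affineSegment_eq_segment]; exact ⟨t, ht, rfl⟩)

theorem center_mem_of_isPerpCline {Ω : Sphere P} {m : AffineSubspace ℝ P} {X : P}
    (hΩ : 0 < Ω.radius) (hm : Module.finrank ℝ m.direction = 1) (hXm : X ∈ m)
    (hXΩ : X ∈ Ω) (h : m.direction ⟂ (Ω.orthRadius X).direction) : Ω.center ∈ m := by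
  have hx : X -ᵥ Ω.center ≠ 0 := by
    rw [vsub_ne_zero]
    rintro h'
    exact hΩ.ne' (by rw [← mem_sphere.1 hXΩ, h', dist_self])
  rw [Sphere.direction_orthRadius, Submodule.isOrtho_iff_le, Submodule.orthogonal_orthogonal] at h
  have := Submodule.eq_of_le_of_finrank_eq h (by rw [hm, finrank_span_singleton hx])
  rw [← AffineSubspace.vsub_left_mem_direction_iff_mem hXm, this]
  exact Submodule.mem_span_singleton_self _

theorem exists_eq_smul_vsub_of_finrank_direction {m : AffineSubspace ℝ P} {O Q A : P}
    (hm : Module.finrank ℝ m.direction = 1) (hO : O ∈ m) (hQ : Q ∈ m) (hA : A ∈ m)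
    (hQA : Q ≠ A) : ∃ k : ℝ, Q -ᵥ O = k • (A -ᵥ Q) := by
  let v : m.direction := ⟨A -ᵥ Q, AffineSubspace.vsub_mem_direction hA hQ⟩
  obtain ⟨k, hk⟩ := (finrank_eq_one_iff_of_nonzero' v
    (by simpa [v, Subtype.ext_iff, vsub_eq_zero_iff_eq] using hQA.symm)).1 hm
    ⟨Q -ᵥ O, AffineSubspace.vsub_mem_direction hQ hO⟩
  exact ⟨k, (congrArg Subtype.val hk).symm⟩

end Lines

section TwoDim

variable {V P : Type*} [NormedAddCommGroup V] [InnerProductSpace ℝ V] [MetricSpace P]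
  [NormedAddTorsor V P] [Fact (Module.finrank ℝ V = 2)]

theorem norm_sq_eq_of_isPerpCline {Ω S : Sphere P} {X : P} (hXS : X ∈ S) (hXΩ : X ∈ Ω)
    (h : (S.orthRadius X).direction ⟂ (Ω.orthRadius X).direction) :
    ‖S.center -ᵥ Ω.center‖ ^ 2 = Ω.radius ^ 2 + S.radius ^ 2 := by
  rw [Sphere.direction_orthRadius, Sphere.direction_orthRadius] at h
  have := inner_eq_zero_of_isOrtho_orthogonal h
  rw [← vsub_sub_vsub_cancel_left S.center Ω.center X, norm_sub_sq_real, real_inner_comm, this,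
    ← dist_eq_norm_vsub V, ← dist_eq_norm_vsub V, mem_sphere.1 hXS, mem_sphere.1 hXΩ]
  ring

theorem isPerpCline_of_norm_sq_eq {Ω S : Sphere P} (hΩ : 0 < Ω.radius) (hS : 0 < S.radius)
    (h : ‖S.center -ᵥ Ω.center‖ ^ 2 = Ω.radius ^ 2 + S.radius ^ 2) :
    IsPerpCline Ω (S : Set P) := by
  have : FiniteDimensional ℝ V := .of_fact_finrank_eq_two
  let o : Orientation ℝ V (Fin 2) :=
    ((stdOrthonormalBasis ℝ V).toBasis.reindex (finCongr Fact.out)).orientation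
  set m := S.center -ᵥ Ω.center with hm
  set r := Ω.radius
  set ρ := S.radius
  have hm0 : ‖m‖ ≠ 0 := pow_ne_zero_iff two_ne_zero |>.1 (by rw [h]; positivity)
  -- A point of contact of a tangent from `m` to the absolute: `inner ℝ x m = r ^ 2` and `‖x‖ = r`.
  set x : V := (r ^ 2 / ‖m‖ ^ 2) • m + (r * ρ / ‖m‖ ^ 2) • o.rightAngleRotation m with hx
  have hxm : inner ℝ x m = r ^ 2 := by
    rw [hx, inner_add_left, real_inner_smul_left, real_inner_smul_left,
      o.inner_rightAngleRotation_self, real_inner_self_eq_norm_sq]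
    field_simp
    simp
  have hxx : ‖x‖ ^ 2 = r ^ 2 := by
    rw [hx, norm_add_sq_real, real_inner_smul_left, real_inner_smul_right, real_inner_comm,
      o.inner_rightAngleRotation_self, norm_smul, norm_smul, mul_pow, mul_pow, Real.norm_eq_abs,
      Real.norm_eq_abs, sq_abs, sq_abs, LinearIsometryEquiv.norm_map]
    field_simp
    linear_combination (-‖m‖ ^ 2) * h
  have hxS : x +ᵥ Ω.center ∈ S := by
    rw [mem_sphere_iff_of_norm_sq_eq hS h, vadd_vsub, hxm, hxx]
    ring
  have hxΩ : x +ᵥ Ω.center ∈ Ω := by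
    rw [mem_sphere, dist_eq_norm_vsub V, vadd_vsub, ← sq_eq_sq₀ (norm_nonneg _) hΩ.le, hxx]
  refine .inl ⟨S, hS, rfl, x +ᵥ Ω.center, hxS, hxΩ, ?_⟩
  rw [Sphere.direction_orthRadius, Sphere.direction_orthRadius]
  refine isOrtho_orthogonal_of_inner_eq_zero ?_ ?_ ?_
  · rw [vsub_ne_zero]
    rintro h'
    exact hS.ne' ((mem_sphere.1 hxS).symm.trans (by rw [h', dist_self]))
  · rw [vsub_ne_zero]
    rintro h'
    exact hΩ.ne' ((mem_sphere.1 hxΩ).symm.trans (by rw [h', dist_self]))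
  · rw [vadd_vsub, vadd_vsub_assoc, ← neg_vsub_eq_vsub_rev S.center, ← hm, ← sub_eq_add_neg,
      inner_sub_left, real_inner_self_eq_norm_sq, real_inner_comm, hxm, hxx, sub_self]

variable (o : Orientation ℝ V (Fin 2))

theorem mem_line_iff_areaForm {Q A X : P} (hQA : Q ≠ A) :
    X ∈ line[ℝ, Q, A] ↔ o.areaForm (A -ᵥ Q) (X -ᵥ Q) = 0 := by
  rw [mem_line_iff]
  constructor
  · rintro ⟨k, hk⟩
    simp [← hk]
  · intro h
    obtain ⟨k, hk⟩ := exists_eq_smul_of_areaForm_eq_zero o (vsub_ne_zero.2 hQA.symm) h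
    exact ⟨k, hk.symm⟩

theorem sSameSide_line_iff {Q A X Y : P} (hQA : Q ≠ A) :
    line[ℝ, Q, A].SSameSide X Y ↔
      0 < o.areaForm (A -ᵥ Q) (X -ᵥ Q) * o.areaForm (A -ᵥ Q) (Y -ᵥ Q) := by
  rw [AffineSubspace.SSameSide, mem_line_iff_areaForm o hQA, mem_line_iff_areaForm o hQA]
  constructor
  · rintro ⟨⟨p₁, hp₁, p₂, hp₂, h⟩, hX, hY⟩
    rw [mem_line_iff_areaForm o hQA] at hp₁ hp₂
    have e₁ : o.areaForm (A -ᵥ Q) (X -ᵥ p₁) = o.areaForm (A -ᵥ Q) (X -ᵥ Q) := by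
      rw [← vsub_sub_vsub_cancel_right X p₁ Q, map_sub, hp₁, sub_zero]
    have e₂ : o.areaForm (A -ᵥ Q) (Y -ᵥ p₂) = o.areaForm (A -ᵥ Q) (Y -ᵥ Q) := by
      rw [← vsub_sub_vsub_cancel_right Y p₂ Q, map_sub, hp₂, sub_zero]
    obtain ⟨c, hc, hcX⟩ := h.exists_pos_left (by rintro h; simp [h] at e₁; exact hX e₁.symm)
      (by rintro h; simp [h] at e₂; exact hY e₂.symm)
    rw [← e₂, ← hcX, map_smul, e₁, smul_eq_mul]
    have : 0 < o.areaForm (A -ᵥ Q) (X -ᵥ Q) ^ 2 := by positivity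
    nlinarith
  · intro h
    have hX := left_ne_zero_of_mul h.ne'
    have hY := right_ne_zero_of_mul h.ne'
    refine ⟨?_, hX, hY⟩
    set σX := o.areaForm (A -ᵥ Q) (X -ᵥ Q)
    set σY := o.areaForm (A -ᵥ Q) (Y -ᵥ Q)
    obtain ⟨c, hc⟩ := exists_eq_smul_of_areaForm_eq_zero o (vsub_ne_zero.2 hQA.symm)
      (y := (X -ᵥ Q) - (σX / σY) • (Y -ᵥ Q))
      (by rw [map_sub, map_smul, smul_eq_mul, div_mul_cancel₀ _ hY, sub_self])
    refine ⟨c • (A -ᵥ Q) +ᵥ Q, mem_line_iff.2 ⟨c, by rw [vadd_vsub]⟩, Q,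
      left_mem_affineSpan_pair ℝ Q A, ?_⟩
    rw [vsub_vadd_eq_vsub_sub, ← hc, sub_sub_cancel]
    refine SameRay.sameRay_pos_smul_left _ ?_
    rw [← mul_div_mul_right _ _ hY]
    exact div_pos h (mul_self_pos.2 hY)

end TwoDim

end PoincareDisk

namespace PoincareDisk

/-! ### Tangent half-lines and h-angles -/

section TwoDim

variable {V P : Type*} [NormedAddCommGroup V] [InnerProductSpace ℝ V] [MetricSpace P]
  [NormedAddTorsor V P] [Fact (Module.finrank ℝ V = 2)]

/-- A circle arc shares three points with its h-line, so the h-line lies on the same circle. A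
segment contains three collinear points, so its h-line is a diameter. An exterior arc is unbounded.
-/
theorem exists_pos_vsub_eq_smul_tangentVec {Ω : Sphere P} (hΩ : 0 < Ω.radius) {Q A X : P}
    (hQ : Q ∈ hPlane Ω) (hA : A ∈ hPlane Ω) (h : IsTangentToHSegment Ω Q A X) :
    ∃ k : ℝ, 0 < k ∧
      X -ᵥ Q = k • tangentVec Ω.radius (Q -ᵥ Ω.center) (A -ᵥ Ω.center) := by
  have : FiniteDimensional ℝ V := .of_fact_finrank_eq_two
  let o : Orientation ℝ V (Fin 2) :=
    ((stdOrthonormalBasis ℝ V).toBasis.reindex (finCongr Fact.out)).orientation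
  obtain ⟨γ, _, ⟨Γ, hΓ, rfl⟩, hγ, h⟩ := h
  have hQ' := mem_hPlane_iff.1 hQ
  have hA' := mem_hPlane_iff.1 hA
  cases h with
  | circle S _ B _ _ hQS hBS hAS hQB hBA hQA hX hside =>
    have hsub (D : P) (hD : D ∈ circleArc S Q B A) : D ∈ Γ := (hγ hD).2
    have hBside : line[ℝ, Q, A].SSameSide B B :=
      ⟨⟨Q, left_mem_affineSpan_pair ℝ Q A, Q, left_mem_affineSpan_pair ℝ Q A, .rfl⟩,
        hside.2.2, hside.2.2⟩
    have hQΓ := hsub Q ⟨hQS, .inl rfl⟩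
    have hAΓ := hsub A ⟨hAS, .inr (.inl rfl)⟩
    have hBΓ := hsub B ⟨hBS, .inr (.inr hBside)⟩
    rcases hΓ with ⟨S', hS', rfl, Y, hYS', hYΩ, hperp⟩ | ⟨m, hm, rfl, Y, hYm, hYΩ, hperp⟩
    · have hSS' : S = S' := by
        by_contra hne
        rcases eq_of_mem_sphere_of_mem_sphere_of_finrank_eq_two (Fact.out : Module.finrank ℝ V = 2)
          hne hQA hQS hAS hBS hQΓ hAΓ hBΓ with h | h
        · exact hQB h.symm
        · exact hBA h
      subst hSS'
      have hS := norm_sq_eq_of_isPerpCline hYS' hYΩ hperp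
      rw [sSameSide_line_iff o hQA] at hside
      simp only [mem_sphere_iff_of_norm_sq_eq hS' hS] at hQS hAS
      refine exists_pos_eq_smul_tangentVec o (b := B -ᵥ Ω.center) hQ' hA'
        (by simpa using hQA) hQS hAS ?_ ?_ fun d hd hdB ↦ ?_
      · rw [vsub_sub_vsub_cancel_right]
        exact Sphere.mem_orthRadius_iff_inner_left.1 hX
      · rwa [vsub_sub_vsub_cancel_right, vsub_sub_vsub_cancel_right]
      · have := (hγ (a := d +ᵥ Ω.center) ⟨?_, .inr (.inr ?_)⟩).1
        · rwa [mem_hPlane_iff, vadd_vsub] at this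
        · rwa [mem_sphere_iff_of_norm_sq_eq hS' hS, vadd_vsub]
        · rw [sSameSide_line_iff o hQA]
          rwa [vsub_sub_vsub_cancel_right, vsub_sub_vsub_cancel_right, ← vadd_vsub d Ω.center,
            vsub_sub_vsub_cancel_right] at hdB
    · refine (hside.2.2 ?_).elim
      obtain ⟨k, hk⟩ := exists_eq_smul_vsub_of_finrank_direction hm hBΓ hQΓ hAΓ hQA
      exact mem_line_iff.2 ⟨-k, by rw [neg_smul, ← hk, neg_vsub_eq_vsub_rev]⟩
  | segment _ _ _ hQA hXQ hX =>
    have hQΓ : Q ∈ Γ := (hγ (left_mem_affineSegment ℝ Q A)).2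
    have hAΓ : A ∈ Γ := (hγ (right_mem_affineSegment ℝ Q A)).2
    have hMΓ : midpoint ℝ Q A ∈ Γ := (hγ (wbtw_midpoint ℝ Q A)).2
    rcases hΓ with ⟨S, hS, rfl, -⟩ | ⟨m, hm, rfl, Y, hYm, hYΩ, hperp⟩
    · exact (midpoint_notMem_sphere hQA hQΓ hAΓ hMΓ).elim
    · obtain ⟨k, hk⟩ := exists_eq_smul_vsub_of_finrank_direction hm
        (center_mem_of_isPerpCline hΩ hm hYm hYΩ hperp) hQΓ hAΓ hQA
      exact exists_pos_eq_smul_of_affineSegment hQ hA hQA hXQ hX hk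
  | exterior _ _ _ hQA hX =>
    exact (not_subset_hPlane_of_exterior Ω hQA fun D hD ↦ (hγ hD).1).elim

theorem exists_isTangentToHSegment {Ω : Sphere P} {Q A : P} (hQ : Q ∈ hPlane Ω)
    (hA : A ∈ hPlane Ω) (hQA : Q ≠ A) : ∃ X, IsTangentToHSegment Ω Q A X := by
  have : FiniteDimensional ℝ V := .of_fact_finrank_eq_two
  let o : Orientation ℝ V (Fin 2) :=
    ((stdOrthonormalBasis ℝ V).toBasis.reindex (finCongr Fact.out)).orientation
  have hQ' := mem_hPlane_iff.1 hQ
  have hA' := mem_hPlane_iff.1 hA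
  have hΩ : 0 < Ω.radius := (norm_nonneg _).trans_lt hQ'
  have hAQ : A -ᵥ Q ≠ 0 := vsub_ne_zero.2 hQA.symm
  -- The vanishing case is that of a diameter, where the h-segment is Euclidean.
  by_cases hW : o.areaForm (A -ᵥ Q) (Q -ᵥ Ω.center) = 0
  · obtain ⟨k, hk⟩ := exists_eq_smul_of_areaForm_eq_zero o hAQ hW
    refine ⟨A, affineSegment ℝ Q A, _, ⟨_, isPerpCline_mk' hΩ hAQ, rfl⟩,
      Set.subset_inter (affineSegment_subset_hPlane hQ hA) ?_, .segment Q A A hQA hQA.symm .rfl⟩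
    have hQm : Q ∈ AffineSubspace.mk' Ω.center (ℝ ∙ (A -ᵥ Q)) := by
      rw [AffineSubspace.mem_mk', hk]
      exact Submodule.smul_mem _ _ (Submodule.mem_span_singleton_self _)
    have hAm : A ∈ AffineSubspace.mk' Ω.center (ℝ ∙ (A -ᵥ Q)) := by
      rw [AffineSubspace.mem_mk', ← vsub_add_vsub_cancel A Q Ω.center, hk]
      exact Submodule.add_mem _ (Submodule.mem_span_singleton_self _)
        (Submodule.smul_mem _ _ (Submodule.mem_span_singleton_self _))
    rintro _ ⟨t, -, rfl⟩
    exact AffineMap.lineMap_mem t hQm hAm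
  set q := Q -ᵥ Ω.center with hq
  set a := A -ᵥ Ω.center with ha
  have haq : a - q = A -ᵥ Q := vsub_sub_vsub_cancel_right _ _ _
  have hqa : q ≠ a := by simpa [hq, ha] using hQA
  rw [← haq] at hW
  set t := tangentVec Ω.radius q a with ht
  have hA₀ := sq_sub_sq_pos hQ'
  have hD := norm_sub_sq_pos hqa
  have hσt : o.areaForm (a - q) t = -(‖a - q‖ ^ 2 * o.areaForm (a - q) q) :=
    areaForm_sub_tangentVec o _ _ _
  obtain ⟨m, ρ, hρ, hm, hcirc⟩ := exists_center_radius (n := o.rightAngleRotation t) hQ' <| by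
    rw [o.inner_rightAngleRotation_right, ht, tangentVec, map_sub, map_smul, map_smul,
      o.areaForm_apply_self, o.areaForm_swap, smul_zero, sub_zero, smul_neg, neg_neg, smul_eq_mul]
    exact mul_ne_zero hA₀.ne' hW
  have hqm := hcirc q (by simp [tangentVec])
  have ham := hcirc a (by simp [← ht])
  let S : Sphere P := ⟨m +ᵥ Ω.center, ρ⟩
  have hSm : S.center -ᵥ Ω.center = m := vadd_vsub _ _
  have hS : ‖S.center -ᵥ Ω.center‖ ^ 2 = Ω.radius ^ 2 + S.radius ^ 2 := by rw [hSm, hm]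
  have hmem (D : P) : D ∈ S ↔ ‖D -ᵥ Ω.center‖ ^ 2 + Ω.radius ^ 2 =
      2 * inner ℝ (D -ᵥ Ω.center) m := by
    rw [mem_sphere_iff_of_norm_sq_eq hρ hS, hSm]
  have htm := inner_tangentVec_sub_center hqm ham
  rw [← ht] at htm
  have hσd : o.areaForm (a - q) (t + (a - q)) = o.areaForm (a - q) t := by
    rw [map_add, o.areaForm_apply_self, add_zero]
  have hd0 : t + (a - q) ≠ 0 := by
    intro h
    rw [h, hσt, map_zero, eq_comm, neg_eq_zero] at hσd
    exact mul_ne_zero hD.ne' hW hσd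
  have hd := pow_pos (norm_pos_iff.2 hd0) 2
  have hσt0 : o.areaForm (a - q) t ≠ 0 := by
    rw [hσt]; exact neg_ne_zero.2 (mul_ne_zero hD.ne' hW)
  -- The ray from `q` in a direction between the tangent `t` and the chord `a - q` meets the circle
  -- again on the side of `t`. As `t` is orthogonal to `q - m` and `2 * inner ℝ (a - q) (q - m) =
  -- -‖a - q‖ ^ 2`, this happens at parameter `c`.
  set c := ‖a - q‖ ^ 2 / ‖t + (a - q)‖ ^ 2 with hc
  have hc0 : 0 < c := div_pos hD hd
  have hcd : c * ‖t + (a - q)‖ ^ 2 = ‖a - q‖ ^ 2 := div_mul_cancel₀ _ hd.ne'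
  set B : P := c • (t + (a - q)) +ᵥ Q with hB
  have hBO : B -ᵥ Ω.center = q + c • (t + (a - q)) := by
    rw [hB, vadd_vsub_assoc, add_comm]
  have hσB : o.areaForm (A -ᵥ Q) (B -ᵥ Q) = c * o.areaForm (a - q) t := by
    rw [hB, vadd_vsub, ← haq, map_smul, hσd, smul_eq_mul]
  have hσB0 : o.areaForm (A -ᵥ Q) (B -ᵥ Q) ≠ 0 := by
    rw [hσB]; exact mul_ne_zero hc0.ne' hσt0
  have hBS : B ∈ S := by
    rw [hmem, hBO, norm_add_sq_real, norm_smul, Real.norm_of_nonneg hc0.le, mul_pow]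
    have h₁ : 2 * inner ℝ (a - q) (q - m) = -‖a - q‖ ^ 2 := by
      simp only [← real_inner_self_eq_norm_sq, inner_sub_left, inner_sub_right,
        real_inner_comm q a] at hqm ham ⊢
      linear_combination ham - hqm
    rw [inner_add_left, real_inner_smul_left, real_inner_smul_right]
    have h₂ : inner ℝ (t + (a - q)) (q - m) = inner ℝ q (t + (a - q)) -
        inner ℝ (t + (a - q)) m := by rw [inner_sub_right, real_inner_comm]
    rw [inner_add_left, htm, zero_add] at h₂
    linear_combination hqm + c * hcd + c * h₁ - 2 * c * h₂
  refine ⟨t +ᵥ Q, circleArc S Q B A, _, ⟨_, isPerpCline_of_norm_sq_eq hΩ hρ hS, rfl⟩, ?_,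
    .circle S Q B A _ ((hmem Q).2 hqm) hBS ((hmem A).2 ham) ?_ ?_ hQA ?_ ?_⟩
  · rintro D ⟨hDS, hD'⟩
    refine ⟨?_, hDS⟩
    rcases hD' with rfl | rfl | hside
    · exact hQ
    · exact hA
    · rw [sSameSide_line_iff o hQA, hσB, hσt] at hside
      rw [mem_hPlane_iff]
      refine norm_lt_of_areaForm_mul_areaForm_neg o hQ' hA' hqa hqm ham ((hmem D).1 hDS) ?_
      rw [haq, vsub_sub_vsub_cancel_right]
      rw [haq] at hside hD
      have hcD : 0 < c * ‖A -ᵥ Q‖ ^ 2 := mul_pos hc0 hD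
      by_contra! hneg
      nlinarith [mul_nonneg hcD.le hneg]
  · rintro h
    rw [← h, vsub_self, map_zero] at hσB0
    exact hσB0 rfl
  · rintro h
    rw [h, o.areaForm_apply_self] at hσB0
    exact hσB0 rfl
  · rw [Sphere.mem_orthRadius_iff_inner_left, vadd_vsub, ← vsub_sub_vsub_cancel_right Q _ Ω.center,
      hSm]
    exact htm
  · rw [sSameSide_line_iff o hQA, hσB, vadd_vsub, ← haq, mul_left_comm]
    exact mul_pos hc0 (mul_self_pos.2 hσt0)

/-- An h-line is determined by a point and a direction: parallel tangents at `A` share a normal, and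
the diameter or orthogonal circle with that normal passes through `B` and `C`. -/
theorem areaForm_tangentVec_ne_zero (o : Orientation ℝ V (Fin 2)) {Ω : Sphere P} {A B C : P}
    (hA : A ∈ hPlane Ω) (hB : B ∈ hPlane Ω) (hC : C ∈ hPlane Ω) (hAB : A ≠ B)
    (hnd : ¬ IsHDegenerate Ω A B C) :
    o.areaForm (tangentVec Ω.radius (A -ᵥ Ω.center) (B -ᵥ Ω.center))
      (tangentVec Ω.radius (A -ᵥ Ω.center) (C -ᵥ Ω.center)) ≠ 0 := by
  intro h
  apply hnd
  have hA' := mem_hPlane_iff.1 hA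
  have hB' := mem_hPlane_iff.1 hB
  have hΩ : 0 < Ω.radius := (norm_nonneg _).trans_lt hA'
  have hA₀ := sq_sub_sq_pos hA'
  set a := A -ᵥ Ω.center with ha
  set b := B -ᵥ Ω.center with hb
  set c := C -ᵥ Ω.center with hc
  set t := tangentVec Ω.radius a b with ht
  have ht0 : t ≠ 0 := tangentVec_ne_zero hA' hB' (by simpa [ha, hb] using hAB)
  have hcn : inner ℝ (tangentVec Ω.radius a c) (o.rightAngleRotation t) = 0 := by
    rw [real_inner_comm, o.inner_rightAngleRotation_left, h]
  have hbn : inner ℝ (tangentVec Ω.radius a b) (o.rightAngleRotation t) = 0 := by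
    simp [← ht]
  by_cases hat : inner ℝ a (o.rightAngleRotation t) = 0
  · refine ⟨_, ⟨_, isPerpCline_mk' hΩ ht0, rfl⟩, ?_⟩
    have key (D : P) (hD : inner ℝ (tangentVec Ω.radius a (D -ᵥ Ω.center))
        (o.rightAngleRotation t) = 0) : D ∈ AffineSubspace.mk' Ω.center (ℝ ∙ t) := by
      rw [AffineSubspace.mem_mk', Submodule.mem_span_singleton]
      rw [tangentVec, inner_sub_left, real_inner_smul_left, real_inner_smul_left, inner_sub_left,
        hat, mul_zero, sub_zero, sub_zero, mul_eq_zero, real_inner_comm,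
        o.inner_rightAngleRotation_left] at hD
      obtain ⟨k, hk⟩ := exists_eq_smul_of_areaForm_eq_zero o ht0 (hD.resolve_left hA₀.ne')
      exact ⟨k, hk.symm⟩
    exact ⟨⟨hA, key A (by simp [tangentVec, ← ha])⟩, ⟨hB, key B hbn⟩, hC, key C hcn⟩
  · obtain ⟨m, ρ, hρ, hm, hcirc⟩ := exists_center_radius hA' hat
    let S : Sphere P := ⟨m +ᵥ Ω.center, ρ⟩
    have hSm : S.center -ᵥ Ω.center = m := vadd_vsub _ _
    have hS : ‖S.center -ᵥ Ω.center‖ ^ 2 = Ω.radius ^ 2 + S.radius ^ 2 := by rw [hSm, hm]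
    have key (D : P) (hD : inner ℝ (tangentVec Ω.radius a (D -ᵥ Ω.center))
        (o.rightAngleRotation t) = 0) : D ∈ S := by
      rw [mem_sphere_iff_of_norm_sq_eq hρ hS, hSm]
      exact hcirc _ hD
    exact ⟨_, ⟨_, isPerpCline_of_norm_sq_eq hΩ hρ hS, rfl⟩,
      ⟨hA, key A (by simp [tangentVec, ← ha])⟩, ⟨hB, key B hbn⟩, hC, key C hcn⟩

/-- Existence of tangent half-lines makes the choice in `hAngle` meaningful; their uniqueness up to
positive scaling makes the result independent of it. -/
theorem abs_hAngle [Module.Oriented ℝ V (Fin 2)] {Ω : Sphere P} {A Q B : P} (hA : A ∈ hPlane Ω)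
    (hQ : Q ∈ hPlane Ω) (hB : B ∈ hPlane Ω) (hQA : Q ≠ A) (hQB : Q ≠ B) :
    |hAngle Ω A Q B| = InnerProductGeometry.angle
      (tangentVec Ω.radius (Q -ᵥ Ω.center) (A -ᵥ Ω.center))
      (tangentVec Ω.radius (Q -ᵥ Ω.center) (B -ᵥ Ω.center)) := by
  have hQ' := mem_hPlane_iff.1 hQ
  have hΩ : 0 < Ω.radius := (norm_nonneg _).trans_lt hQ'
  obtain ⟨X₀, hX₀⟩ := exists_isTangentToHSegment hQ hA hQA
  obtain ⟨Y₀, hY₀⟩ := exists_isTangentToHSegment hQ hB hQB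
  obtain ⟨X, Y, hX, hY, h⟩ : IsHAngleMeasure Ω A Q B (hAngle Ω A Q B) :=
    Classical.epsilon_spec ⟨_, X₀, Y₀, hX₀, hY₀, rfl⟩
  obtain ⟨k, hk, hkX⟩ := exists_pos_vsub_eq_smul_tangentVec hΩ hQ hA hX
  obtain ⟨l, hl, hlY⟩ := exists_pos_vsub_eq_smul_tangentVec hΩ hQ hB hY
  have hXQ : X ≠ Q := by
    rw [← vsub_ne_zero (G := V), hkX]
    exact smul_ne_zero hk.ne' (tangentVec_ne_zero hQ' (mem_hPlane_iff.1 hA) (by simpa using hQA))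
  have hYQ : Y ≠ Q := by
    rw [← vsub_ne_zero (G := V), hlY]
    exact smul_ne_zero hl.ne' (tangentVec_ne_zero hQ' (mem_hPlane_iff.1 hB) (by simpa using hQB))
  rw [h, ← angle_eq_abs_oangle_toReal hXQ hYQ, EuclideanGeometry.angle, hkX, hlY,
    InnerProductGeometry.angle_smul_left_of_pos _ _ hk,
    InnerProductGeometry.angle_smul_right_of_pos _ _ hl]

end TwoDim

end PoincareDisk

theorem mainTheorem9 {V P : Type*} [NormedAddCommGroup V] [InnerProductSpace ℝ V]
    [MetricSpace P] [NormedAddTorsor V P] [Fact (Module.finrank ℝ V = 2)]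
    [Module.Oriented ℝ V (Fin 2)] (Ω : EuclideanGeometry.Sphere P) (hΩ : 0 < Ω.radius)
    (A B C : P) (hABC : PoincareDisk.IsHTriangle Ω A B C)
    (hnd : ¬ PoincareDisk.IsHDegenerate Ω A B C) :
    0 < PoincareDisk.hDefect Ω A B C := by
  obtain ⟨hA, hB, hC, hAB, hBC, hCA⟩ := hABC
  rw [PoincareDisk.hDefect, PoincareDisk.abs_hAngle hA hB hC hAB.symm hBC,
    PoincareDisk.abs_hAngle hB hC hA hBC.symm hCA, PoincareDisk.abs_hAngle hC hA hB hCA.symm hAB,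
    sub_pos, InnerProductGeometry.angle_comm (PoincareDisk.tangentVec _ (B -ᵥ _) _),
    InnerProductGeometry.angle_comm (PoincareDisk.tangentVec _ (C -ᵥ _) _),
    InnerProductGeometry.angle_comm (PoincareDisk.tangentVec _ (A -ᵥ _) _)]
  have := PoincareDisk.angle_add_angle_add_angle_lt_pi (PoincareDisk.mem_hPlane_iff.1 hA)
    (PoincareDisk.mem_hPlane_iff.1 hB) (PoincareDisk.mem_hPlane_iff.1 hC) (by simpa using hAB)
    (by simpa using hBC) (by simpa using hCA) (PoincareDisk.gramFactor_pos EuclideanGeometry.o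
      (PoincareDisk.areaForm_tangentVec_ne_zero EuclideanGeometry.o hA hB hC hAB hnd))
  linarith
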